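/- For integers $a,b,r\ge 0$ and $\ell\in\mathbb Z$, let $\mathcal G_{a,b}^{\ge r,\ell}$ be the set of lattice paths starting at the origin with $a$ steps $U=(1,1)$ and $b$ steps $D=(1,-1)$, in any order, that cross the line $y=\ell$ at least $r$ times; here a crossing is a vertex of the path on the line $y=\ell$ that is either preceded and followed by a $U$, or preceded and followed by a $D$. Number the vertices of a path along it, starting with $0$. A descent is a vertex preceded by a $D$ and followed by a $U$; $\mathrm{des}(P)$ is the number of descents of $P$, and $\mathrm{maj}(P)$ is the sum of their positions. Let $$G_{a,b}^{\ge r,\ell}(t,q)=\sum_{P\in\mathcal G_{a,b}^{\ge r,\ell}}t^{\mathrm{des}(P)}q^{\mathrm{maj}(P)}.$$ For integers $j,k$ let $\binom{j}{k}_q=\frac{(1-q^j)(1-q^{j-1})\cdots(1-q^{j-k+1})}{(1-q^k)(1-q^{k-1})\cdots(1-q)}$ if $0\le k\le j$, and $\binom{j}{k}_q=0$ otherwise. **Theorem.** Let $a,b,m\ge0$ be integers and let $\ell\in\mathbb Z$. I. If $0<\ell<a-b$, then $$G_{a,b}^{\ge 2m+1,\ell}(t,q)=G_{a,b}^{\ge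 2m,\ell}(t,q)=\sum_{n\ge0}t^nq^{n^2+m(m+\ell+1)}\binom{a}{n-m}_q\binom{b}{n+m}_q.$$ II. If $0>\ell>a-b$, then $$G_{a,b}^{\ge 2m+1,\ell}(t,q)=G_{a,b}^{\ge 2m,\ell}(t,q)=\sum_{n\ge0}t^nq^{n^2+m(m-\ell-1)}\binom{a}{n+m}_q\binom{b}{n-m}_q.$$ III. If $\ell<0$ and $\ell<a-b$, then $$G_{a,b}^{\ge 2m+2,\ell}(t,q)=G_{a,b}^{\ge 2m+1,\ell}(t,q)=\sum_{n\ge0}t^nq^{n^2+(m+1)(m-\ell)}\binom{a-\ell-1}{n-m-1}_q\binom{b+\ell+1}{n+m+1}_q.$$ IV. If $\ell>0$ and $\ell>a-b$, then $$G_{a,b}^{\ge 2m+2,\ell}(t,q)=G_{a,b}^{\ge 2m+1,\ell}(t,q)=\sum_{n\ge0}t^nq^{n^2+m(m+\ell+1)}\binom{a-\ell-1}{n+m}_q\binom{b+\ell+1}{n-m}_q.$$ V. If $0=\ell<a-b$, then $$G_{a,b}^{\ge 2m,\ell}(t,q)=\sum_{n\ge0}t^nq^{n^2+m(m+1)}\binom{a}{n-m}_q\binom{b}{n+m}_q,$$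 $$G_{a,b}^{\ge 2m+1,\ell}(t,q)=\sum_{n\ge0}t^nq^{n^2+m(m+1)}\binom{a-1}{n-m-1}_q\binom{b+1}{n+m+1}_q.$$ VI. If $0=\ell>a-b$, then $$G_{a,b}^{\ge 2m,\ell}(t,q)=\sum_{n\ge0}t^nq^{n^2+m(m-1)}\binom{a}{n+m}_q\binom{b}{n-m}_q,$$ $$G_{a,b}^{\ge 2m+1,\ell}(t,q)=\sum_{n\ge0}t^nq^{n^2+m(m+1)}\binom{a-1}{n+m}_q\binom{b+1}{n-m}_q.$$ VII. If $0<\ell=a-b$, then $$G_{a,b}^{\ge 2m,\ell}(t,q)=\sum_{n\ge0}t^nq^{n^2+m(m+\ell+1)}\binom{a}{n-m}_q\binom{b}{n+m}_q,$$ $$G_{a,b}^{\ge 2m+1,\ell}(t,q)=\sum_{n\ge0}t^nq^{n^2+m(m+\ell+1)}\binom{a+1}{n-m}_q\binom{b-1}{n+m}_q.$$ VIII. If $0>\ell=a-b$, then $$G_{a,b}^{\ge 2m,\ell}(t,q)=\sum_{n\ge0}t^nq^{n^2+m(m-\ell-1)}\binom{a}{n+m}_q\binom{b}{n-m}_q,$$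 $$G_{a,b}^{\ge 2m+1,\ell}(t,q)=\sum_{n\ge0}t^nq^{n^2+(m+1)(m-\ell)}\binom{a+1}{n+m+1}_q\binom{b-1}{n-m-1}_q.$$ IX. If $0=\ell=a-b$ and $a\ge1$, then $$G_{a,b}^{\ge 2m,\ell}(t,q)=\sum_{n\ge0}t^nq^{n^2+m(m+1)}\frac{1-q^{a-2m}}{1-q^a}\binom{a}{n+m}_q\binom{a}{n-m}_q,$$ $$G_{a,b}^{\ge 2m+1,\ell}(t,q)=\sum_{n\ge0}t^nq^{n^2+m(m+1)}\frac{1-q^{a+2(m+1)}}{1-q^a}\binom{a}{n+m+1}_q\binom{a}{n-m-1}_q.$$ If $\ell=a=b=0$ (where the fractions in these two formulas would have denominator $0$), then $G_{0,0}^{\ge 0,0}(t,q)=1$ and $G_{0,0}^{\ge r,0}(t,q)=0$ for all $r\ge1$. -/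

import Mathlib

open Polynomial

namespace LatticePath

/-- The two kinds of steps: up, `U = (1, 1)`, and down, `D = (1, -1)`. -/
inductive Step : Type
  | U : Step
  | D : Step
  deriving DecidableEq

instance : Finite Step :=
  Finite.of_injective (fun s : Step => decide (s = Step.U)) (by
    intro s s'; cases s <;> cases s' <;> simp)

/-- A lattice path starting at the origin, given by its sequence of steps. Its vertices are
numbered `0, 1, …, P.length`; vertex `i` is preceded by the step `P[i - 1]` (if `1 ≤ i`)
and followed by the step `P[i]` (if `i < P.length`). -/
abbrev Path : Type := List Step

/-- The ordinate of vertex `i` of the path `P`. -/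
def height (P : Path) (i : ℕ) : ℤ :=
  ((P.take i).count Step.U : ℤ) - ((P.take i).count Step.D : ℤ)

/-- The positions of the descents (valleys): the vertices preceded by a `D` and followed
by a `U`. -/
def descents (P : Path) : Finset ℕ :=
  (Finset.Ico 1 P.length).filter
    (fun i => P[i - 1]? = some Step.D ∧ P[i]? = some Step.U)

/-- The number of descents. -/
def des (P : Path) : ℕ := (descents P).card

/-- The major index: the sum of the positions of the descents. -/
def maj (P : Path) : ℕ := ∑ i ∈ descents P, i

/-- The crossings of the line `y = ℓ`: the (interior) vertices on that line which are preceded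
and followed by a `D`, or preceded and followed by a `U`. -/
def crossings (ℓ : ℤ) (P : Path) : Finset ℕ :=
  (Finset.Ico 1 P.length).filter
    (fun i => height P i = ℓ ∧
      ((P[i - 1]? = some Step.D ∧ P[i]? = some Step.D) ∨
        (P[i - 1]? = some Step.U ∧ P[i]? = some Step.U)))

/-- The set of paths with `a` steps `U` and `b` steps `D`, starting at the origin, that cross the
line `y = ℓ` at least `r` times. -/
def crossingPaths (a b r : ℕ) (ℓ : ℤ) : Set Path :=
  {P | P.count Step.U = a ∧ P.count Step.D = b ∧ r ≤ (crossings ℓ P).card}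

theorem length_eq_count (P : Path) : P.length = P.count Step.U + P.count Step.D := by
  induction P with
  | nil => rfl
  | cons s P ih => cases s <;> simp [ih] <;> omega

/-- There are finitely many such paths, so that the sum in `G` below is a genuine finite sum. -/
theorem crossingPaths_finite (a b r : ℕ) (ℓ : ℤ) : (crossingPaths a b r ℓ).Finite := by
  refine (List.finite_length_eq Step (a + b)).subset ?_
  rintro P ⟨hU, hD, -⟩
  simp [length_eq_count, hU, hD]

noncomputable section

/-- The indeterminate `q`, in the field `ℚ(q)` of rational functions. -/
def q : RatFunc ℚ := RatFunc.X

/-- The indeterminate `t`, in the polynomial ring `ℚ(q)[t]`. -/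
def t : (RatFunc ℚ)[X] := Polynomial.X

/-- The `q`-binomial coefficient
`(1 - q^m)(1 - q^(m-1)) ⋯ (1 - q^(m-n+1)) / ((1 - q^n)(1 - q^(n-1)) ⋯ (1 - q))`
if `0 ≤ n ≤ m`, and `0` for all other integers `m, n`. -/
def qbin (m n : ℤ) : RatFunc ℚ :=
  if 0 ≤ n ∧ n ≤ m then
    (∏ i ∈ Finset.range n.toNat, (1 - q ^ (m - i))) /
      (∏ i ∈ Finset.range n.toNat, (1 - q ^ (n - i)))
  else 0

/-- The generating polynomial `G_{a,b}^{≥ r, ℓ}(t, q)`, as an element of `ℚ(q)[t]`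
(which contains `ℤ[t, q]`). -/
def G (a b r : ℕ) (ℓ : ℤ) : (RatFunc ℚ)[X] :=
  ∑ᶠ P ∈ crossingPaths a b r ℓ, t ^ des P * C (q ^ maj P)

/-- The sum `∑_{n ≥ 0} t^n c_n` for a finitely supported sequence `c` of elements of `ℚ(q)`. -/
def tSum (c : ℕ → RatFunc ℚ) : (RatFunc ℚ)[X] :=
  ∑ᶠ n : ℕ, t ^ n * C (c n)

end

end LatticePath

open LatticePath

/-! ### Recursion on the last step of a path. -/

namespace LatticePath

/-! Split the paths by their last step. Deleting that step changes `des`, `maj` and the number of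
crossings only through the vertex before it: a turn `DU` there contributes `t q^(a+b)`, and `UU` or
`DD` on the line contributes one crossing. This gives a coupled recursion for the paths ending with
`U` and those ending with `D`, which determines both sums, so closed forms only have to be checked
against it.

Away from the line every closed form is a term `q^(n²+c) [x, n+s] [y, n-s]`, and the recursion is a
product of two `q`-Pascal rules (`qterm_step`). One formula `A` serves end points above the line and
another, `B`, those below. Meeting the line trades `A` for `B` and lowers `r` by one. Going down,
this is the symmetry `qterm_swap`; going up, it is the reflection `qterm_reflect`. `IsClosedForm`
collects these conditions, `isClosedForm` verifies them, and the cases of the theorem follow by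
reading off `A`, `B`, or a mixture of them for end points on the line. -/

/-- The weight `t^des(P) q^maj(P)` of a path. -/
noncomputable def weight (P : Path) : (RatFunc ℚ)[X] := t ^ des P * C (q ^ maj P)

theorem height_append_left (P Q : Path) {i : ℕ} (hi : i ≤ P.length) :
    height (P ++ Q) i = height P i := by
  simp [height, List.take_append_of_le_length hi]

theorem height_length (P : Path) :
    height P P.length = (P.count Step.U : ℤ) - P.count Step.D := by
  simp [height]

theorem descents_append_singleton (P : Path) (s s' : Step) :
    descents (P ++ [s] ++ [s']) =
      if s = Step.D ∧ s' = Step.U then insert (P.length + 1) (descents (P ++ [s]))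
      else descents (P ++ [s]) := by
  have h : Finset.Ico 1 (P ++ [s] ++ [s']).length =
      insert (P.length + 1) (Finset.Ico 1 (P ++ [s]).length) := by
    ext i; simp; omega
  have h2 : (Finset.Ico 1 (P ++ [s]).length).filter (fun i =>
      (P ++ [s] ++ [s'])[i - 1]? = some Step.D ∧ (P ++ [s] ++ [s'])[i]? = some Step.U) =
      descents (P ++ [s]) := by
    refine Finset.filter_congr fun i hi => ?_
    rw [Finset.mem_Ico] at hi
    rw [List.getElem?_append_left hi.2, List.getElem?_append_left (by omega)]
  rw [descents, h, Finset.filter_insert, h2]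
  simp

theorem crossings_append_singleton (ℓ : ℤ) (P : Path) (s s' : Step) :
    crossings ℓ (P ++ [s] ++ [s']) =
      if height (P ++ [s]) (P ++ [s]).length = ℓ ∧ s = s' then
        insert (P.length + 1) (crossings ℓ (P ++ [s]))
      else crossings ℓ (P ++ [s]) := by
  have h : Finset.Ico 1 (P ++ [s] ++ [s']).length =
      insert (P.length + 1) (Finset.Ico 1 (P ++ [s]).length) := by
    ext i; simp; omega
  have h2 : (Finset.Ico 1 (P ++ [s]).length).filter (fun i =>
      height (P ++ [s] ++ [s']) i = ℓ ∧
      (((P ++ [s] ++ [s'])[i - 1]? = some Step.D ∧ (P ++ [s] ++ [s'])[i]? = some Step.D) ∨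
        ((P ++ [s] ++ [s'])[i - 1]? = some Step.U ∧ (P ++ [s] ++ [s'])[i]? = some Step.U))) =
      crossings ℓ (P ++ [s]) := by
    refine Finset.filter_congr fun i hi => ?_
    rw [Finset.mem_Ico] at hi
    rw [List.getElem?_append_left hi.2, List.getElem?_append_left (by omega),
      height_append_left _ _ hi.2.le]
  rw [crossings, h, Finset.filter_insert, h2]
  have h3 : height (P ++ [s] ++ [s']) (P.length + 1) = height (P ++ [s]) (P ++ [s]).length := by
    rw [height_append_left _ _ (by simp)]; simp
  rw [h3]
  cases s <;> cases s' <;> simp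

theorem weight_append_singleton (P : Path) (s s' : Step) :
    weight (P ++ [s] ++ [s']) =
      (if s = Step.D ∧ s' = Step.U then
        t * C (q ^ ((P ++ [s]).count Step.U + (P ++ [s]).count Step.D)) else 1) *
        weight (P ++ [s]) := by
  unfold weight des maj
  rw [descents_append_singleton, ← length_eq_count]
  split_ifs with h
  · have hn : P.length + 1 ∉ descents (P ++ [s]) := by simp [descents]
    rw [Finset.card_insert_of_notMem hn, Finset.sum_insert hn]
    simp only [List.length_append, List.length_singleton, pow_succ, pow_add, map_mul, map_pow]
    ring
  · simp

theorem card_crossings_append_singleton (ℓ : ℤ) (P : Path) (s s' : Step) :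
    (crossings ℓ (P ++ [s] ++ [s'])).card = (crossings ℓ (P ++ [s])).card +
      if ((P ++ [s]).count Step.U : ℤ) - (P ++ [s]).count Step.D = ℓ ∧ s = s' then 1 else 0 := by
  rw [crossings_append_singleton, height_length]
  split_ifs with h
  · rw [Finset.card_insert_of_notMem (by simp [crossings])]
  · simp

theorem crossings_length_le_one (ℓ : ℤ) (P : Path) (h : P.length ≤ 1) : crossings ℓ P = ∅ := by
  rw [crossings, Finset.Ico_eq_empty (by omega), Finset.filter_empty]

theorem weight_length_le_one (P : Path) (h : P.length ≤ 1) : weight P = 1 := by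
  have : descents P = ∅ := by rw [descents, Finset.Ico_eq_empty (by omega), Finset.filter_empty]
  simp [weight, des, maj, this]

/-- A sum over a finite set of paths, split by the last step. -/
theorem finsum_mem_paths_by_last_step {M : Type*} [AddCommMonoid M] (f : Path → M) {S : Set Path}
    (hS : S.Finite) :
    ∑ᶠ P ∈ S, f P = (∑ᶠ _ : [] ∈ S, f []) + (∑ᶠ P ∈ {P | P ++ [Step.U] ∈ S}, f (P ++ [Step.U])) +
      ∑ᶠ P ∈ {P | P ++ [Step.D] ∈ S}, f (P ++ [Step.D]) := by
  have inj : ∀ s : Step, Function.Injective (fun P : Path => P ++ [s]) :=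
    fun s => List.append_left_injective [s]
  have key : S = {P | P = [] ∧ [] ∈ S} ∪ (fun P : Path => P ++ [Step.U]) '' {P | P ++ [Step.U] ∈ S} ∪
      (fun P : Path => P ++ [Step.D]) '' {P | P ++ [Step.D] ∈ S} := by
    ext P
    rcases List.eq_nil_or_concat' P with rfl | ⟨Q, s, rfl⟩
    · simp
    · cases s <;> simp
  have f1 : (fun P : Path => P ++ [Step.U]) '' {P | P ++ [Step.U] ∈ S} ⊆ S := by
    rintro _ ⟨P, hP, rfl⟩; exact hP
  have f2 : (fun P : Path => P ++ [Step.D]) '' {P | P ++ [Step.D] ∈ S} ⊆ S := by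
    rintro _ ⟨P, hP, rfl⟩; exact hP
  have f0 : {P | P = [] ∧ [] ∈ S} ⊆ S := by
    rintro _ ⟨rfl, hP⟩; exact hP
  conv_lhs => rw [key]
  rw [finsum_mem_union _ ((hS.subset f0).union (hS.subset f1)) (hS.subset f2),
    finsum_mem_union _ (hS.subset f0) (hS.subset f1),
    finsum_mem_image (inj _).injOn, finsum_mem_image (inj _).injOn]
  · congr 2
    by_cases h : ([] : Path) ∈ S
    · simp [h]
    · simp [h]
  · rw [Set.disjoint_left]
    rintro P ⟨rfl, -⟩ ⟨Q, -, h⟩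
    simp at h
  · rw [Set.disjoint_left]
    rintro P (⟨rfl, -⟩ | ⟨Q, -, rfl⟩) ⟨R, -, h⟩
    · simp at h
    · simp at h

/-- The generating polynomial of the paths in `crossingPaths a b r ℓ` whose last step is `s`. -/
noncomputable def lastStepSum (s : Step) (a b r : ℕ) (ℓ : ℤ) : (RatFunc ℚ)[X] :=
  ∑ᶠ P ∈ {P | P ++ [s] ∈ crossingPaths a b r ℓ}, weight (P ++ [s])

/-- The generating polynomial of the empty path, if it lies in `crossingPaths a b r ℓ`. -/
noncomputable def emptySum (a b r : ℕ) : (RatFunc ℚ)[X] :=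
  if a = 0 ∧ b = 0 ∧ r = 0 then 1 else 0

theorem nil_mem_crossingPaths (a b r : ℕ) (ℓ : ℤ) :
    [] ∈ crossingPaths a b r ℓ ↔ a = 0 ∧ b = 0 ∧ r = 0 := by
  simp [crossingPaths, crossings_length_le_one, eq_comm]

open Classical in
theorem G_eq_add (a b r : ℕ) (ℓ : ℤ) :
    G a b r ℓ =
      emptySum a b r + lastStepSum Step.U a b r ℓ + lastStepSum Step.D a b r ℓ := by
  change ∑ᶠ P ∈ crossingPaths a b r ℓ, weight P = _
  rw [finsum_mem_paths_by_last_step _ (crossingPaths_finite a b r ℓ), emptySum, lastStepSum,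
    lastStepSum, finsum_eq_if, weight_length_le_one _ (by simp)]
  simp only [nil_mem_crossingPaths]

theorem lastStepSum_eq_add (s : Step) (a b r : ℕ) (ℓ : ℤ) :
    lastStepSum s a b r ℓ =
      (∑ᶠ _ : [s] ∈ crossingPaths a b r ℓ, 1) +
      (∑ᶠ P ∈ {P | P ++ [Step.U] ++ [s] ∈ crossingPaths a b r ℓ}, weight (P ++ [Step.U] ++ [s])) +
      ∑ᶠ P ∈ {P | P ++ [Step.D] ++ [s] ∈ crossingPaths a b r ℓ},
        weight (P ++ [Step.D] ++ [s]) := by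
  have hfin : {P | P ++ [s] ∈ crossingPaths a b r ℓ}.Finite :=
    (crossingPaths_finite a b r ℓ).preimage (List.append_left_injective [s]).injOn
  rw [lastStepSum, finsum_mem_paths_by_last_step _ hfin]
  rw [weight_length_le_one _ (by simp)]
  rfl

/-- The new crossing, if any, is the vertex before the last step, at height `a - b`. Truncated
subtraction is right here: for `r = 0` the demand on crossings is void and stays void. -/
theorem append_mem_crossingPaths_up (P : Path) (s : Step) (a b r : ℕ) (ℓ : ℤ) :
    P ++ [s] ++ [Step.U] ∈ crossingPaths (a + 1) b r ℓ ↔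
      P ++ [s] ∈ crossingPaths a b (if (a : ℤ) - b = ℓ ∧ s = Step.U then r - 1 else r) ℓ := by
  have h1 : (P ++ [s] ++ [Step.U]).count Step.U = (P ++ [s]).count Step.U + 1 := by
    rw [List.count_append]; simp
  have h2 : (P ++ [s] ++ [Step.U]).count Step.D = (P ++ [s]).count Step.D := by
    rw [List.count_append]; simp
  simp only [crossingPaths, Set.mem_ofPred_eq, card_crossings_append_singleton, h1, h2,
    Nat.add_right_cancel_iff]
  refine and_congr_right fun ha => and_congr_right fun hb => ?_
  rw [ha, hb]
  split_ifs <;> omega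

theorem append_mem_crossingPaths_down (P : Path) (s : Step) (a b r : ℕ) (ℓ : ℤ) :
    P ++ [s] ++ [Step.D] ∈ crossingPaths a (b + 1) r ℓ ↔
      P ++ [s] ∈ crossingPaths a b (if (a : ℤ) - b = ℓ ∧ s = Step.D then r - 1 else r) ℓ := by
  have h1 : (P ++ [s] ++ [Step.D]).count Step.D = (P ++ [s]).count Step.D + 1 := by
    rw [List.count_append]; simp
  have h2 : (P ++ [s] ++ [Step.D]).count Step.U = (P ++ [s]).count Step.U := by
    rw [List.count_append]; simp
  simp only [crossingPaths, Set.mem_ofPred_eq, card_crossings_append_singleton, h1, h2,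
    Nat.add_right_cancel_iff]
  refine and_congr_right fun ha => and_congr_right fun hb => ?_
  rw [ha, hb]
  split_ifs <;> omega

-- The empty path behaves like a path ending with `U` as far as descents go, since neither produces
-- one when a step is appended. But vertex `0` is never a crossing, so its `r` is not lowered.
open Classical in
theorem lastStepSum_up_succ (a b r : ℕ) (ℓ : ℤ) :
    lastStepSum Step.U (a + 1) b r ℓ = emptySum a b r +
      lastStepSum Step.U a b (if (a : ℤ) - b = ℓ then r - 1 else r) ℓ +
      t * C (q ^ (a + b)) * lastStepSum Step.D a b r ℓ := by
  rw [lastStepSum_eq_add]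
  simp only [append_mem_crossingPaths_up]
  congr 1
  · congr 1
    · rw [finsum_eq_if, emptySum]
      simp [crossingPaths, crossings_length_le_one, eq_comm]
    · simp [lastStepSum, weight_append_singleton, -List.append_assoc]
  · rw [lastStepSum, mul_finsum_mem]
    simp only [reduceCtorEq, and_false, if_false]
    refine finsum_mem_congr rfl fun P hP => ?_
    rw [weight_append_singleton, if_pos ⟨rfl, rfl⟩, hP.1, hP.2.1]

open Classical in
theorem lastStepSum_down_succ (a b r : ℕ) (ℓ : ℤ) :
    lastStepSum Step.D a (b + 1) r ℓ = emptySum a b r + lastStepSum Step.U a b r ℓ +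
      lastStepSum Step.D a b (if (a : ℤ) - b = ℓ then r - 1 else r) ℓ := by
  rw [lastStepSum_eq_add]
  simp only [append_mem_crossingPaths_down]
  congr 1
  · congr 1
    · rw [finsum_eq_if, emptySum]
      simp [crossingPaths, crossings_length_le_one, eq_comm]
    · simp [lastStepSum, weight_append_singleton, -List.append_assoc]
  · simp [lastStepSum, weight_append_singleton, -List.append_assoc]

theorem lastStepSum_up_zero (b r : ℕ) (ℓ : ℤ) : lastStepSum Step.U 0 b r ℓ = 0 := by
  simp [lastStepSum, crossingPaths]

theorem lastStepSum_down_zero (a r : ℕ) (ℓ : ℤ) : lastStepSum Step.D a 0 r ℓ = 0 := by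
  simp [lastStepSum, crossingPaths]

end LatticePath

/-! ### `q`-binomial identities. -/

namespace LatticePath

theorem q_ne_zero : q ≠ 0 := RatFunc.X_ne_zero

theorem q_pow_ne_one {n : ℕ} (hn : n ≠ 0) : q ^ n ≠ 1 := by
  intro h
  have h1 : algebraMap ℚ[X] (RatFunc ℚ) (X ^ n) = algebraMap ℚ[X] (RatFunc ℚ) 1 := by
    rw [map_pow, map_one, RatFunc.algebraMap_X]; exact h
  have h2 := congrArg natDegree (RatFunc.algebraMap_injective ℚ h1)
  simp [hn] at h2

theorem one_sub_q_zpow_ne_zero {n : ℤ} (hn : 0 < n) : 1 - q ^ n ≠ 0 := by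
  lift n to ℕ using hn.le
  rw [zpow_natCast, sub_ne_zero]
  exact (q_pow_ne_one (by omega)).symm

/-- The numerator of the `q`-binomial coefficient. -/
noncomputable def qfall (x : ℤ) (k : ℕ) : RatFunc ℚ := ∏ i ∈ Finset.range k, (1 - q ^ (x - i))

theorem qfall_succ (x : ℤ) (k : ℕ) : qfall x (k + 1) = qfall x k * (1 - q ^ (x - k)) :=
  Finset.prod_range_succ _ _

theorem qfall_succ' (x : ℤ) (k : ℕ) : qfall x (k + 1) = qfall (x - 1) k * (1 - q ^ x) := by
  rw [qfall, Finset.prod_range_succ', qfall]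
  congr 1
  · refine Finset.prod_congr rfl fun i _ => ?_
    congr 2
    push_cast
    ring
  · simp

theorem qfall_self_ne_zero (k : ℕ) : qfall k k ≠ 0 := by
  refine Finset.prod_ne_zero_iff.2 fun i hi => one_sub_q_zpow_ne_zero ?_
  rw [Finset.mem_range] at hi
  omega

theorem qfall_eq_zero {x : ℤ} {k : ℕ} (hx : 0 ≤ x) (hk : x < k) : qfall x k = 0 := by
  lift x to ℕ using hx
  refine Finset.prod_eq_zero (Finset.mem_range.2 (by omega : x < k)) ?_
  simp

/-- For `k > x` the numerator contains the factor `1 - q^0`, so the quotient agrees with the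
convention that the coefficient is `0`. -/
theorem qbin_natCast {x : ℤ} (hx : 0 ≤ x) (k : ℕ) : qbin x k = qfall x k / qfall k k := by
  unfold qbin
  split_ifs with h
  · rfl
  · rw [qfall_eq_zero hx (by omega), zero_div]

theorem qbin_of_neg_right (x : ℤ) {k : ℤ} (hk : k < 0) : qbin x k = 0 := if_neg (by omega)

theorem qbin_of_lt {x k : ℤ} (hk : x < k) : qbin x k = 0 := if_neg (by omega)

theorem qbin_of_neg_left {x : ℤ} (hx : x < 0) (k : ℤ) : qbin x k = 0 := if_neg (by omega)

theorem qbin_zero_right {x : ℤ} (hx : 0 ≤ x) : qbin x 0 = 1 := by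
  have := qbin_natCast hx 0
  simpa [qfall] using this

theorem qbin_sub_one_mul {x : ℤ} (hx : 0 < x) (k : ℤ) :
    qbin (x - 1) k * (1 - q ^ x) = qbin x k * (1 - q ^ (x - k)) := by
  rcases lt_or_ge k 0 with hk | hk
  · simp [qbin_of_neg_right _ hk]
  lift k to ℕ using hk
  rw [qbin_natCast hx.le, qbin_natCast (by omega), div_mul_eq_mul_div, div_mul_eq_mul_div,
    ← qfall_succ', qfall_succ]

theorem qbin_sub_one_sub_one_mul {x : ℤ} (hx : 0 < x) (k : ℤ) :
    qbin (x - 1) (k - 1) * (1 - q ^ x) = qbin x k * (1 - q ^ k) := by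
  rcases lt_or_ge k 0 with hk | hk
  · simp [qbin_of_neg_right _ hk, qbin_of_neg_right (x - 1) (show k - 1 < 0 by omega)]
  lift k to ℕ using hk
  rcases k with _ | k
  · simp [qbin_of_neg_right]
  have h1 : qfall (k : ℤ) k ≠ 0 := qfall_self_ne_zero k
  have h2 : 1 - q ^ ((k : ℤ) + 1) ≠ 0 := one_sub_q_zpow_ne_zero (by omega)
  have h3 : ((k + 1 : ℕ) : ℤ) - 1 = (k : ℕ) := by simp
  rw [qbin_natCast hx.le, h3, qbin_natCast (by omega), qfall_succ', qfall_succ', h3]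
  push_cast
  field_simp

/-- The `q`-Pascal rule. -/
theorem qbin_sub_qbin_sub_one {x : ℤ} (hx : x ≠ 0) (k : ℤ) :
    qbin x k - qbin (x - 1) k = q ^ (x - k) * qbin (x - 1) (k - 1) := by
  rcases lt_or_gt_of_ne hx with hx | hx
  · simp [qbin_of_neg_left hx, qbin_of_neg_left (show x - 1 < 0 by omega)]
  have h := one_sub_q_zpow_ne_zero hx
  rw [← mul_left_inj' h, sub_mul, mul_assoc, qbin_sub_one_mul hx, qbin_sub_one_sub_one_mul hx]
  have : q ^ x = q ^ (x - k) * q ^ k := by rw [← zpow_add₀ q_ne_zero]; simp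
  rw [this]
  ring

/-- The coefficient `q^(n² + c) [x, n + s]_q [y, n - s]_q`. -/
noncomputable def qterm (c x y s n : ℤ) : RatFunc ℚ :=
  q ^ (n ^ 2 + c) * (qbin x (n + s) * qbin y (n - s))

theorem qterm_of_neg (c x y s : ℤ) {n : ℤ} (hn : n < 0) : qterm c x y s n = 0 := by
  unfold qterm
  rcases lt_or_ge (n + s) 0 with h | h
  · simp [qbin_of_neg_right _ h]
  · simp [qbin_of_neg_right _ (show n - s < 0 by omega)]

theorem qterm_swap (c x y s n : ℤ) : qterm c x y s n = qterm c y x (-s) n := by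
  unfold qterm
  rw [sub_neg_eq_add, ← sub_eq_add_neg, mul_comm (qbin x _)]

theorem qterm_of_neg_left (c y s n : ℤ) {x : ℤ} (hx : x < 0) : qterm c x y s n = 0 := by
  simp [qterm, qbin_of_neg_left hx]

theorem qterm_of_neg_right (c x s n : ℤ) {y : ℤ} (hy : y < 0) : qterm c x y s n = 0 := by
  simp [qterm, qbin_of_neg_left hy]

/-- `qterm` satisfies the recursion for paths away from the line. -/
theorem qterm_step {c x y s n : ℤ} (hn : 0 ≤ n) (hx : x ≠ -1 ∨ 0 < s ∨ (s = 0 ∧ y ≠ 0))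
    (hy : y ≠ 0 ∨ s < 0 ∨ (s = 0 ∧ 0 ≤ x)) :
    qterm c (x + 1) y s n - qterm c (x + 1) (y - 1) s n =
      qterm c x y s n - qterm c x (y - 1) s n + q ^ (x + y) * qterm c x (y - 1) s (n - 1) := by
  -- A product of two Pascal rules. Pascal's rule fails only for `[0, 0]`; the hypotheses force `n =
  -- s = 0` in that event, and then the other factor vanishes.
  have key : (qbin (x + 1) (n + s) - qbin x (n + s)) * (qbin y (n - s) - qbin (y - 1) (n - s)) =
      q ^ (x + 1 - (n + s)) * qbin x (n + s - 1) *
        (q ^ (y - (n - s)) * qbin (y - 1) (n - s - 1)) := by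
    by_cases hx' : x = -1
    · subst hx'
      by_cases h0 : n + s = 0
      · have hs : s = 0 := by omega
        have hn0 : n = 0 := by omega
        subst hs hn0
        rw [qbin_sub_qbin_sub_one (by omega : y ≠ 0)]
        simp [qbin_of_neg_right]
      · have h1 : qbin 0 (n + s) = 0 := by
          rcases lt_or_gt_of_ne h0 with h | h
          · exact qbin_of_neg_right _ h
          · exact qbin_of_lt h
        simp [qbin_of_neg_left, h1]
    · have h1 := qbin_sub_qbin_sub_one (show x + 1 ≠ 0 by omega) (n + s)
      rw [add_sub_cancel_right] at h1
      rw [h1]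
      by_cases hy' : y = 0
      · subst hy'
        by_cases h0 : n - s = 0
        · have hs : s = 0 := by omega
          have hn0 : n = 0 := by omega
          subst hs hn0
          simp [qbin_of_neg_right]
        · have h1 : qbin 0 (n - s) = 0 := by
            rcases lt_or_gt_of_ne h0 with h | h
            · exact qbin_of_neg_right _ h
            · exact qbin_of_lt h
          simp [qbin_of_neg_left, h1]
      · rw [qbin_sub_qbin_sub_one hy']
  -- The shift `s` cancels and the Pascal exponents add up to `x + y + (n - 1)² - n²`; this is what
  -- requires the quadratic exponent `n²`.
  have e : q ^ (n ^ 2 + c) * (q ^ (x + 1 - (n + s)) * q ^ (y - (n - s))) =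
      q ^ (x + y) * q ^ ((n - 1) ^ 2 + c) := by
    simp only [← zpow_add₀ q_ne_zero]
    congr 1
    ring
  unfold qterm
  rw [show n - 1 + s = n + s - 1 by ring, show n - 1 - s = n - s - 1 by ring]
  linear_combination q ^ (n ^ 2 + c) * key + qbin x (n + s - 1) * qbin (y - 1) (n - s - 1) * e

/-- The reflection of `qterm` used when a path meets the line. -/
theorem qterm_reflect {c c' x y s n : ℤ} (hn : 0 ≤ n) (hx : x ≠ -1) (hy : y ≠ 0 ∨ s < 0)
    (hc : c' = c + y - x + 2 * s) :
    qterm c x y s n - qterm c x (y - 1) s n =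
      qterm c' (y - 1) (x + 1) (-s - 1) n - qterm c' (y - 1) x (-s - 1) n := by
  by_cases hy' : y = 0
  · subst hy'
    have h1 : qbin 0 (n - s) = 0 := qbin_of_lt (by omega)
    simp [qterm, qbin_of_neg_left, h1]
  -- Pascal's rule in `y` on the left and in `x + 1` on the right yields the same product `[x, n+s]
  -- [y-1, n-s-1]`; comparing powers of `q` dictates `c'`.
  have h1 := qbin_sub_qbin_sub_one (show x + 1 ≠ 0 by omega) (n - (-s - 1))
  have h2 := qbin_sub_qbin_sub_one hy' (n - s)
  rw [add_sub_cancel_right, show n - (-s - 1) - 1 = n + s by ring] at h1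
  have e : q ^ (n ^ 2 + c) * q ^ (y - (n - s)) =
      q ^ (n ^ 2 + c') * q ^ (x + 1 - (n - (-s - 1))) := by
    simp only [← zpow_add₀ q_ne_zero]
    congr 1
    rw [hc]
    ring
  unfold qterm
  rw [show n + (-s - 1) = n - s - 1 by ring]
  linear_combination q ^ (n ^ 2 + c) * qbin x (n + s) * h2 -
    q ^ (n ^ 2 + c') * qbin (y - 1) (n - s - 1) * h1 + qbin x (n + s) * qbin (y - 1) (n - s - 1) * e

end LatticePath

/-! ### Conditions under which closed forms solve the recursion. -/

namespace LatticePath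

/-- The coefficient of `t^n` in the generating polynomial of the paths ending with `U`, to which
the empty path is added. -/
noncomputable def upCoeff (ℓ : ℤ) (a b r n : ℕ) : RatFunc ℚ :=
  (emptySum a b r + lastStepSum Step.U a b r ℓ).coeff n

/-- The coefficient of `t^n` in the generating polynomial of the paths ending with `D`. -/
noncomputable def downCoeff (ℓ : ℤ) (a b r n : ℕ) : RatFunc ℚ :=
  (lastStepSum Step.D a b r ℓ).coeff n

theorem coeff_G (ℓ : ℤ) (a b r n : ℕ) :
    (G a b r ℓ).coeff n = upCoeff ℓ a b r n + downCoeff ℓ a b r n := by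
  rw [G_eq_add, coeff_add, upCoeff, downCoeff]

theorem downCoeff_zero (ℓ : ℤ) (a r n : ℕ) : downCoeff ℓ a 0 r n = 0 := by
  rw [downCoeff, lastStepSum_down_zero, coeff_zero]

theorem downCoeff_succ (ℓ : ℤ) (a b r n : ℕ) :
    downCoeff ℓ a (b + 1) r n =
      upCoeff ℓ a b r n + downCoeff ℓ a b (if (a : ℤ) - b = ℓ then r - 1 else r) n := by
  rw [downCoeff, lastStepSum_down_succ, coeff_add, upCoeff, downCoeff]

theorem coeff_emptySum (a b r n : ℕ) :
    (emptySum a b r).coeff n = if a = 0 ∧ b = 0 ∧ r = 0 ∧ n = 0 then 1 else 0 := by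
  unfold emptySum
  split_ifs with h1 h2 h2
  · simp [h2.2.2.2]
  · rw [coeff_one, if_neg (by tauto)]
  · tauto
  · simp

theorem upCoeff_zero (ℓ : ℤ) (b r n : ℕ) :
    upCoeff ℓ 0 b r n = if b = 0 ∧ r = 0 ∧ n = 0 then 1 else 0 := by
  simp [upCoeff, lastStepSum_up_zero, coeff_emptySum]

theorem upCoeff_one_zero (ℓ : ℤ) (r n : ℕ) :
    upCoeff ℓ 1 0 r n = if r = 0 ∧ n = 0 then 1 else 0 := by
  have := lastStepSum_up_succ 0 0 r ℓ
  rw [zero_add] at this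
  simp [upCoeff, this, lastStepSum_up_zero, lastStepSum_down_zero, coeff_emptySum]

/-- The origin on the line is excluded: `upCoeff` includes the empty path, whose `r` must not be
lowered. `upCoeff_one_zero` covers that case. -/
theorem upCoeff_succ {ℓ : ℤ} {a b : ℕ} (h : a ≠ 0 ∨ b ≠ 0 ∨ ℓ ≠ 0) (r n : ℕ) :
    upCoeff ℓ (a + 1) b r n = upCoeff ℓ a b (if (a : ℤ) - b = ℓ then r - 1 else r) n +
      q ^ (a + b) * (if n = 0 then 0 else downCoeff ℓ a b r (n - 1)) := by
  have h0 : emptySum a b (if (a : ℤ) - b = ℓ then r - 1 else r) = emptySum a b r := by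
    split_ifs with hl
    · unfold emptySum
      rw [if_neg (by omega), if_neg (by omega)]
    · rfl
  have h1 : emptySum (a + 1) b r = 0 := by simp [emptySum]
  rw [upCoeff, lastStepSum_up_succ, h1, zero_add, coeff_add, upCoeff, h0]
  congr 1
  rw [t, mul_assoc]
  rcases n with _ | n
  · simp
  · rw [coeff_X_mul, coeff_C_mul]
    simp [downCoeff]

/-- `A` and `B` describe the coefficients of `G` at the end points above and below the line. -/
structure IsClosedForm (ℓ : ℤ) (A B : ℕ → ℤ → ℤ → ℤ → RatFunc ℚ) : Prop where
  -- Vanishing at `n = -1` lets the step recursion, which involves `n - 1`, hold at `n = 0` as well.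
  above_neg_one : ∀ r a b, A r a b (-1) = 0
  below_neg_one : ∀ r a b, B r a b (-1) = 0
  -- The value at `b = -1` stands for the paths ending with `D` when `b = 0`, of which there are
  -- none.
  above_bot : ∀ r a n : ℕ, ℓ ≤ a → A r a (-1) n = 0
  below_bot : ∀ r a n : ℕ, a < ℓ → B r a (-1) n = 0
  above_left : ∀ r b n : ℕ, ℓ < -b →
    A r 0 b n - A r 0 (b - 1) n = if b = 0 ∧ r = 0 ∧ n = 0 then 1 else 0
  below_left : ∀ r b n : ℕ, -b ≤ ℓ →
    B r 0 b n - B r 0 (b - 1) n = if b = 0 ∧ r = 0 ∧ n = 0 then 1 else 0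
  above_one : ∀ r n : ℕ, ℓ = 0 → A r 1 0 n - A r 1 (-1) n = if r = 0 ∧ n = 0 then 1 else 0
  above_step : ∀ r a b n : ℕ, ℓ ≤ a - b → (a ≠ 0 ∨ b ≠ 0 ∨ ℓ ≠ 0) →
    A r (a + 1) b n - A r (a + 1) (b - 1) n =
      A r a b n - A r a (b - 1) n + q ^ (a + b) * A r a (b - 1) (n - 1)
  below_step : ∀ r a b n : ℕ, a - b < ℓ →
    B r (a + 1) b n - B r (a + 1) (b - 1) n =
      B r a b n - B r a (b - 1) n + q ^ (a + b) * B r a (b - 1) (n - 1)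
  -- Both formulas are compared one unit above the line, where `B` is only an extrapolation; this
  -- accounts for a crossing `DD`.
  match_down : ∀ (r : ℕ) (a b n : ℤ), a = b + ℓ + 1 → B r a b n = A (r - 1) a b n
  -- The differences in `b` isolate the paths ending with `U`; this accounts for a crossing `UU`.
  match_up : ∀ r a b n : ℕ, (a : ℤ) - b = ℓ → (a ≠ 0 ∨ b ≠ 0 ∨ ℓ ≠ 0) →
    A r a b n - A r a (b - 1) n = B (r - 1) a b n - B (r - 1) a (b - 1) n

namespace IsClosedForm

variable {ℓ : ℤ} {A B : ℕ → ℤ → ℤ → ℤ → RatFunc ℚ}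

/-- Appending `D` creates no descent, so off the line the paths ending with `D` carry the full
generating function of the previous vertex. An end point on the line is reached by `D` from above,
hence `A` there. -/
theorem downCoeff_eq (h : IsClosedForm ℓ A B) (a : ℕ)
    (hu : ∀ b r n : ℕ, upCoeff ℓ a b r n =
      if (a : ℤ) - b ≤ ℓ then B r a b n - B r a (b - 1) n else A r a b n - A r a (b - 1) n)
    (b : ℕ) : ∀ r n : ℕ, downCoeff ℓ a b r n =
      if (a : ℤ) - b < ℓ then B r a (b - 1) n else A r a (b - 1) n := by
  induction b with
  | zero =>
    intro r n
    rw [downCoeff_zero]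
    split_ifs with hl
    · simpa using (h.below_bot r a n (by simpa using hl)).symm
    · simpa using (h.above_bot r a n (by simpa using hl)).symm
  | succ b ih =>
    intro r n
    rw [downCoeff_succ, hu, ih]
    push_cast
    rw [add_sub_cancel_right]
    rcases lt_trichotomy ((a : ℤ) - b) ℓ with hl | hl | hl
    · rw [if_pos hl.le, if_pos hl, if_neg hl.ne, if_pos (by omega)]
      ring
    -- On the line, `match_down` makes the `DD` contribution cancel the subtracted term of
    -- `upCoeff`.
    · rw [if_pos hl.le, if_neg (by omega), if_pos hl, if_pos (by omega),
        h.match_down r a (b - 1) n (by omega)]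
      ring
    · rw [if_neg (by omega), if_neg (by omega), if_neg (by omega), if_neg (by omega)]
      ring

/-- What is left of the full generating function after removing the paths ending with `D`. An end
point on the line is reached by `U` from below, hence `B` there. -/
theorem upCoeff_eq (h : IsClosedForm ℓ A B) (a : ℕ) :
    ∀ b r n : ℕ, upCoeff ℓ a b r n =
      if (a : ℤ) - b ≤ ℓ then B r a b n - B r a (b - 1) n
      else A r a b n - A r a (b - 1) n := by
  induction a with
  | zero =>
    intro b r n
    rw [upCoeff_zero]
    split_ifs with h1 h2 h2
    · simpa [h1] using (h.below_left r b n (by simpa using h2)).symm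
    · simpa [h1] using (h.above_left r b n (by simpa using h2)).symm
    · simpa [h1] using (h.below_left r b n (by simpa using h2)).symm
    · simpa [h1] using (h.above_left r b n (by simpa using h2)).symm
  | succ a ih =>
    intro b r n
    by_cases h0 : a ≠ 0 ∨ b ≠ 0 ∨ ℓ ≠ 0
    · rw [upCoeff_succ h0, ih, h.downCoeff_eq a ih]
      have hd : (if n = 0 then 0 else if (a : ℤ) - b < ℓ then B r a (b - 1) ((n - 1 : ℕ) : ℤ)
          else A r a (b - 1) ((n - 1 : ℕ) : ℤ)) =
          if (a : ℤ) - b < ℓ then B r a (b - 1) (n - 1) else A r a (b - 1) (n - 1) := by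
        rcases n with _ | n
        · simp [h.above_neg_one, h.below_neg_one]
        · simp
      rw [hd]
      push_cast
      rcases lt_trichotomy ((a : ℤ) - b) ℓ with hl | hl | hl
      · rw [if_pos hl.le, if_pos hl, if_neg hl.ne, if_pos (by omega), h.below_step r a b n hl]
      · rw [if_pos hl.le, if_pos hl, if_neg hl.not_lt, if_neg (by omega),
          h.above_step r a b n hl.ge h0, h.match_up r a b n hl h0]
      · rw [if_neg (by omega), if_neg (by omega), if_neg (by omega), if_neg (by omega),
          h.above_step r a b n hl.le h0]
    · push Not at h0
      obtain ⟨rfl, rfl, rfl⟩ := h0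
      rw [zero_add, upCoeff_one_zero, if_neg (show ¬ (((1 : ℕ) : ℤ) - (0 : ℕ) ≤ 0) by simp)]
      simpa using (h.above_one r n rfl).symm

theorem coeff_G_above (h : IsClosedForm ℓ A B) {a b : ℕ} (hl : ℓ < (a : ℤ) - b) (r n : ℕ) :
    (G a b r ℓ).coeff n = A r a b n := by
  rw [coeff_G, h.upCoeff_eq, h.downCoeff_eq a (h.upCoeff_eq a), if_neg (by omega),
    if_neg (by omega), sub_add_cancel]

theorem coeff_G_below (h : IsClosedForm ℓ A B) {a b : ℕ} (hl : (a : ℤ) - b < ℓ) (r n : ℕ) :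
    (G a b r ℓ).coeff n = B r a b n := by
  rw [coeff_G, h.upCoeff_eq, h.downCoeff_eq a (h.upCoeff_eq a), if_pos (by omega),
    if_pos (by omega), sub_add_cancel]

theorem coeff_G_on (h : IsClosedForm ℓ A B) {a b : ℕ} (hl : ℓ = (a : ℤ) - b) (r n : ℕ) :
    (G a b r ℓ).coeff n = B r a b n - B r a (b - 1) n + A r a (b - 1) n := by
  rw [coeff_G, h.upCoeff_eq, h.downCoeff_eq a (h.upCoeff_eq a), if_pos (by omega),
    if_neg (by omega)]

end IsClosedForm

end LatticePath

/-! ### The explicit closed forms and their verification. -/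

namespace LatticePath

theorem qterm_eq {c x y s n e k j : ℤ} (he : e = n ^ 2 + c) (hk : k = n + s) (hj : j = n - s) :
    qterm c x y s n = q ^ e * (qbin x k * qbin y j) := by
  rw [qterm, he, hk, hj]

/-- The coefficients for end points above the line and even `r = 2 * m`, if `0 ≤ ℓ`. -/
noncomputable def aboveEven (ℓ m a b n : ℤ) : RatFunc ℚ := qterm (m * (m + ℓ + 1)) a b (-m) n

/-- The coefficients for end points above the line and odd `r = 2 * m + 1`, if `ℓ ≤ 0`. -/
noncomputable def aboveOdd (ℓ m a b n : ℤ) : RatFunc ℚ :=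
  qterm ((m + 1) * (m - ℓ)) (a - ℓ - 1) (b + ℓ + 1) (-m - 1) n

/-- The coefficients for end points below the line and even `r = 2 * m`, if `ℓ ≤ 0`. -/
noncomputable def belowEven (ℓ m a b n : ℤ) : RatFunc ℚ := qterm (m * (m - ℓ - 1)) a b m n

/-- The coefficients for end points below the line and odd `r = 2 * m + 1`, if `0 ≤ ℓ`. -/
noncomputable def belowOdd (ℓ m a b n : ℤ) : RatFunc ℚ :=
  qterm (m * (m + ℓ + 1)) (a - ℓ - 1) (b + ℓ + 1) m n

theorem belowOdd_eq_aboveEven {ℓ a b : ℤ} (m n : ℤ) (h : a = b + ℓ + 1) :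
    belowOdd ℓ m a b n = aboveEven ℓ m a b n := by
  rw [belowOdd, aboveEven, qterm_swap]
  congr 1 <;> omega

theorem belowEven_eq_aboveOdd {ℓ a b : ℤ} (m n : ℤ) (h : a = b + ℓ + 1) :
    belowEven ℓ (m + 1) a b n = aboveOdd ℓ m a b n := by
  rw [belowEven, aboveOdd, qterm_swap]
  congr 1
  · ring
  · omega
  · omega

theorem belowEven_zero (ℓ a b n : ℤ) : belowEven ℓ 0 a b n = aboveEven ℓ 0 a b n := by
  simp [belowEven, aboveEven]

/-- On the line the shifted arguments `a - ℓ - 1` and `b + ℓ + 1` become `b - 1` and `a + 1`, so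
this is an instance of `qterm_reflect`. -/
theorem aboveOdd_sub {ℓ a b m n : ℤ} (hn : 0 ≤ n) (hl : a - b = ℓ) (hb : b ≠ 0) (ha : a ≠ -1) :
    aboveOdd ℓ m a b n - aboveOdd ℓ m a (b - 1) n =
      belowEven ℓ m a b n - belowEven ℓ m a (b - 1) n := by
  subst hl
  have := qterm_reflect (c := (m + 1) * (m - (a - b))) (c' := m * (m - (a - b) - 1))
    (x := b - 1) (y := a + 1) (s := -m - 1) hn (by omega) (by omega) (by ring)
  unfold aboveOdd belowEven
  convert this using 3 <;> ring

theorem aboveEven_sub {ℓ a b m n : ℤ} (hn : 0 ≤ n) (hl : a - b = ℓ) (ha : a ≠ -1) (hm : 0 ≤ m) :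
    aboveEven ℓ (m + 1) a b n - aboveEven ℓ (m + 1) a (b - 1) n =
      belowOdd ℓ m a b n - belowOdd ℓ m a (b - 1) n := by
  subst hl
  have := qterm_reflect (c := (m + 1) * (m + 1 + (a - b) + 1)) (c' := m * (m + (a - b) + 1))
    (x := a) (y := b) (s := -(m + 1)) hn (by omega) (by omega) (by ring)
  unfold aboveEven belowOdd
  convert this using 3 <;> ring

/-- The recursion of the path-counting functions away from the line. -/
def StepRecursion (F : ℤ → ℤ → ℤ → RatFunc ℚ) (a b n : ℕ) : Prop :=
  F (a + 1) b n - F (a + 1) (b - 1) n =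
    F a b n - F a (b - 1) n + q ^ (a + b) * F a (b - 1) (n - 1)

theorem aboveEven_step (ℓ : ℤ) (m a b n : ℕ) : StepRecursion (aboveEven ℓ m) a b n := by
  have := qterm_step (c := m * (m + ℓ + 1)) (x := a) (y := b) (s := -m) (n := n) (by omega)
    (by omega) (by omega)
  exact_mod_cast this

theorem belowEven_step (ℓ : ℤ) (m a b n : ℕ) (h : b ≠ 0 ∨ m = 0) :
    StepRecursion (belowEven ℓ m) a b n := by
  have := qterm_step (c := m * (m - ℓ - 1)) (x := a) (y := b) (s := m) (n := n) (by omega)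
    (by omega) (by omega)
  exact_mod_cast this

theorem aboveOdd_step (ℓ : ℤ) (m a b n : ℕ) (h : (a : ℤ) ≠ ℓ) :
    StepRecursion (aboveOdd ℓ m) a b n := by
  have := qterm_step (c := (m + 1) * (m - ℓ)) (x := a - ℓ - 1) (y := b + ℓ + 1) (s := -m - 1)
    (n := n) (by omega) (by omega) (by omega)
  unfold StepRecursion aboveOdd
  rw [← zpow_natCast q (a + b)]
  convert this using 4 <;> (push_cast; ring)

theorem belowOdd_step {ℓ : ℤ} (hl : 0 ≤ ℓ) (m a b n : ℕ) :
    StepRecursion (belowOdd ℓ m) a b n := by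
  have := qterm_step (c := m * (m + ℓ + 1)) (x := a - ℓ - 1) (y := b + ℓ + 1) (s := m)
    (n := n) (by omega) (by omega) (by omega)
  unfold StepRecursion belowOdd
  rw [← zpow_natCast q (a + b)]
  convert this using 4 <;> (push_cast; ring)

/-- The coefficients for end points above the line. -/
noncomputable def above (ℓ : ℤ) (r : ℕ) : ℤ → ℤ → ℤ → RatFunc ℚ :=
  -- For `ℓ ≠ 0` and an end point off the line, the sides of origin and end point fix the parity of
  -- the number of crossings, so two consecutive values of `r` share a formula. For `ℓ = 0` there is
  -- no such constraint and the formula changes with each `r`. The index `r / 2 - 1` occurs only for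
  -- `r ≥ 2`.
  if r % 2 = 0 then
    if 0 ≤ ℓ ∨ r = 0 then aboveEven ℓ ((r / 2 : ℕ) : ℤ) else aboveOdd ℓ ((r / 2 - 1 : ℕ) : ℤ)
  else if 0 < ℓ then aboveEven ℓ ((r / 2 : ℕ) : ℤ) else aboveOdd ℓ ((r / 2 : ℕ) : ℤ)

/-- The coefficients for end points below the line. -/
noncomputable def below (ℓ : ℤ) (r : ℕ) : ℤ → ℤ → ℤ → RatFunc ℚ :=
  if r % 2 = 0 then
    if ℓ ≤ 0 ∨ r = 0 then belowEven ℓ ((r / 2 : ℕ) : ℤ) else belowOdd ℓ ((r / 2 - 1 : ℕ) : ℤ)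
  else if ℓ < 0 then belowEven ℓ ((r / 2 : ℕ) : ℤ) else belowOdd ℓ ((r / 2 : ℕ) : ℤ)

theorem above_even {ℓ : ℤ} {m : ℕ} (h : 0 ≤ ℓ ∨ m = 0) : above ℓ (2 * m) = aboveEven ℓ m := by
  rw [above, if_pos (by omega), if_pos (by omega), Nat.mul_div_cancel_left _ two_pos]

theorem above_even_succ {ℓ : ℤ} {m : ℕ} (h : ℓ < 0) : above ℓ (2 * m + 2) = aboveOdd ℓ m := by
  rw [above, if_pos (by omega), if_neg (by omega), show (2 * m + 2) / 2 - 1 = m by omega]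

theorem above_odd_pos {ℓ : ℤ} {m : ℕ} (h : 0 < ℓ) : above ℓ (2 * m + 1) = aboveEven ℓ m := by
  rw [above, if_neg (by omega), if_pos (by omega), show (2 * m + 1) / 2 = m by omega]

theorem above_odd {ℓ : ℤ} {m : ℕ} (h : ℓ ≤ 0) : above ℓ (2 * m + 1) = aboveOdd ℓ m := by
  rw [above, if_neg (by omega), if_neg (by omega), show (2 * m + 1) / 2 = m by omega]

theorem below_even {ℓ : ℤ} {m : ℕ} (h : ℓ ≤ 0 ∨ m = 0) : below ℓ (2 * m) = belowEven ℓ m := by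
  rw [below, if_pos (by omega), if_pos (by omega), Nat.mul_div_cancel_left _ two_pos]

theorem below_even_succ {ℓ : ℤ} {m : ℕ} (h : 0 < ℓ) : below ℓ (2 * m + 2) = belowOdd ℓ m := by
  rw [below, if_pos (by omega), if_neg (by omega), show (2 * m + 2) / 2 - 1 = m by omega]

theorem below_odd_neg {ℓ : ℤ} {m : ℕ} (h : ℓ < 0) : below ℓ (2 * m + 1) = belowEven ℓ m := by
  rw [below, if_neg (by omega), if_pos (by omega), show (2 * m + 1) / 2 = m by omega]

theorem below_odd {ℓ : ℤ} {m : ℕ} (h : 0 ≤ ℓ) : below ℓ (2 * m + 1) = belowOdd ℓ m := by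
  rw [below, if_neg (by omega), if_neg (by omega), show (2 * m + 1) / 2 = m by omega]

/-- The four families that `above` consists of. -/
theorem above_cases (ℓ : ℤ) (r : ℕ) :
    (∃ m : ℕ, above ℓ r = aboveEven ℓ m ∧ (m = 0 ∧ r = 0 ∨ 0 ≤ ℓ ∧ r = 2 * m ∨
      0 < ℓ ∧ r = 2 * m + 1)) ∨
    (∃ m : ℕ, above ℓ r = aboveOdd ℓ m ∧ ℓ ≤ 0 ∧ r ≠ 0) := by
  rcases Nat.even_or_odd' r with ⟨m, rfl | rfl⟩
  · by_cases h : 0 ≤ ℓ ∨ m = 0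
    · exact Or.inl ⟨m, above_even h, by omega⟩
    · obtain ⟨k, rfl⟩ : ∃ k, m = k + 1 := ⟨m - 1, by omega⟩
      exact Or.inr ⟨k, above_even_succ (by omega), by omega, by omega⟩
  · by_cases h : 0 < ℓ
    · exact Or.inl ⟨m, above_odd_pos h, by omega⟩
    · exact Or.inr ⟨m, above_odd (by omega), by omega, by omega⟩

/-- The four families that `below` consists of. -/
theorem below_cases (ℓ : ℤ) (r : ℕ) :
    (∃ m : ℕ, below ℓ r = belowEven ℓ m ∧ (m = 0 ∧ r = 0 ∨ ℓ ≤ 0 ∧ r = 2 * m ∨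
      ℓ < 0 ∧ r = 2 * m + 1)) ∨
    (∃ m : ℕ, below ℓ r = belowOdd ℓ m ∧ 0 ≤ ℓ ∧ r ≠ 0) := by
  rcases Nat.even_or_odd' r with ⟨m, rfl | rfl⟩
  · by_cases h : ℓ ≤ 0 ∨ m = 0
    · exact Or.inl ⟨m, below_even h, by omega⟩
    · obtain ⟨k, rfl⟩ : ∃ k, m = k + 1 := ⟨m - 1, by omega⟩
      exact Or.inr ⟨k, below_even_succ (by omega), by omega, by omega⟩
  · by_cases h : ℓ < 0
    · exact Or.inl ⟨m, below_odd_neg h, by omega⟩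
    · exact Or.inr ⟨m, below_odd (by omega), by omega, by omega⟩

theorem qbin_zero_left (k : ℤ) : qbin 0 k = if k = 0 then 1 else 0 := by
  split_ifs with h
  · rw [h, qbin_zero_right le_rfl]
  · rcases lt_or_gt_of_ne h with h | h
    · exact qbin_of_neg_right _ h
    · exact qbin_of_lt h

/-- The contribution of the empty path. -/
theorem qterm_zero_left_sub {c : ℤ} (b m n : ℕ) (h : m = 0 → c = 0) :
    qterm c 0 b m n - qterm c 0 (b - 1) m n = if b = 0 ∧ m = 0 ∧ n = 0 then 1 else 0 := by
  unfold qterm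
  rw [qbin_zero_left]
  by_cases h0 : m = 0 ∧ n = 0
  · obtain ⟨rfl, rfl⟩ := h0
    rcases b with _ | b
    · simp [h rfl, qbin_zero_right, qbin_of_neg_left]
    · have : qbin ((b : ℤ) + 1) 0 = 1 := qbin_zero_right (by omega)
      simp [qbin_zero_right, this]
  · rw [if_neg (by omega), if_neg (by omega)]
    simp

theorem isClosedForm (ℓ : ℤ) : IsClosedForm ℓ (above ℓ) (below ℓ) where
  above_neg_one r a b := by
    rcases above_cases ℓ r with ⟨m, h, -⟩ | ⟨m, h, -⟩ <;> rw [h] <;>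
      exact qterm_of_neg _ _ _ _ (by norm_num)
  below_neg_one r a b := by
    rcases below_cases ℓ r with ⟨m, h, -⟩ | ⟨m, h, -⟩ <;> rw [h] <;>
      exact qterm_of_neg _ _ _ _ (by norm_num)
  above_bot r a n hl := by
    rcases above_cases ℓ r with ⟨m, h, -⟩ | ⟨m, h, h1, -⟩ <;> rw [h]
    · exact qterm_of_neg_right _ _ _ _ (by norm_num)
    · rw [aboveOdd, qterm, qbin_of_lt (show -1 + ℓ + 1 < (n : ℤ) - (-m - 1) by omega)]
      simp
  below_bot r a n hl := by
    rcases below_cases ℓ r with ⟨m, h, -⟩ | ⟨m, h, h1, -⟩ <;> rw [h]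
    · exact qterm_of_neg_right _ _ _ _ (by norm_num)
    · exact qterm_of_neg_left _ _ _ _ (by omega)
  above_left r b n hl := by
    rcases above_cases ℓ r with ⟨m, h, h1⟩ | ⟨m, h, h1, h2⟩ <;> rw [h]
    · obtain ⟨rfl, rfl⟩ : m = 0 ∧ r = 0 := by omega
      simpa [aboveEven] using qterm_zero_left_sub (c := 0) b 0 n (by simp)
    · rw [if_neg (by omega), aboveOdd, qterm, aboveOdd, qterm,
        qbin_of_lt (show (b : ℤ) + ℓ + 1 < (n : ℤ) - (-m - 1) by omega),
        qbin_of_lt (show (b : ℤ) - 1 + ℓ + 1 < (n : ℤ) - (-m - 1) by omega)]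
      simp
  below_left r b n hl := by
    rcases below_cases ℓ r with ⟨m, h, h1⟩ | ⟨m, h, h1, h2⟩ <;> rw [h]
    · rw [belowEven, belowEven, qterm_zero_left_sub b m n (by rintro rfl; simp)]
      congr 1
      simp only [eq_iff_iff]
      omega
    · rw [if_neg (by omega), belowOdd, belowOdd, qterm_of_neg_left _ _ _ _ (by omega),
        qterm_of_neg_left _ _ _ _ (by omega), sub_zero]
  above_one r n hl := by
    subst hl
    rcases above_cases 0 r with ⟨m, h, h1⟩ | ⟨m, h, h1, h2⟩ <;> rw [h]
    · rw [aboveEven, aboveEven, qterm_of_neg_right _ _ _ _ (show (-1 : ℤ) < 0 by norm_num), qterm, qbin_zero_left]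
      by_cases h0 : m = 0 ∧ n = 0
      · obtain ⟨rfl, rfl⟩ := h0
        have : r = 0 := by omega
        simp [this, qbin_zero_right]
      · rw [if_neg (by omega), if_neg (by omega)]
        simp
    · rw [if_neg (by omega), aboveOdd, aboveOdd, qterm, qterm, show (1 : ℤ) - 0 - 1 = 0 by norm_num, qbin_zero_left]
      by_cases h0 : n = m + 1
      · rw [qbin_of_lt (show (0 : ℤ) + 0 + 1 < n - (-m - 1) by omega),
          qbin_of_lt (show (-1 : ℤ) + 0 + 1 < n - (-m - 1) by omega)]
        simp
      · rw [if_neg (by omega)]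
        simp
  above_step r a b n hl h0 := by
    rcases above_cases ℓ r with ⟨m, h, -⟩ | ⟨m, h, h1, -⟩ <;> rw [h]
    · exact aboveEven_step ℓ m a b n
    -- Here `ℓ ≤ 0`, so `a = ℓ` would force `a = b = ℓ = 0`, which `h0` excludes.
    · exact aboveOdd_step ℓ m a b n (by omega)
  below_step r a b n hl := by
    rcases below_cases ℓ r with ⟨m, h, h1⟩ | ⟨m, h, h1, -⟩ <;> rw [h]
    · exact belowEven_step ℓ m a b n (by omega)
    · exact belowOdd_step h1 m a b n
  match_down r a b n hl := by
    rcases Nat.even_or_odd' r with ⟨m, rfl | rfl⟩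
    · rcases m with _ | m
      · have h1 := above_even (ℓ := ℓ) (m := 0) (Or.inr rfl)
        have h2 := below_even (ℓ := ℓ) (m := 0) (Or.inr rfl)
        rw [mul_zero] at h1 h2
        rw [mul_zero, zero_tsub, h2, h1]
        exact belowEven_zero _ _ _ _
      · rw [show 2 * (m + 1) - 1 = 2 * m + 1 by omega]
        rcases lt_or_ge 0 ℓ with h | h
        · rw [mul_add, mul_one, below_even_succ h, above_odd_pos h, belowOdd_eq_aboveEven _ _ hl]
        · rw [below_even (Or.inl h), above_odd h, Nat.cast_succ, belowEven_eq_aboveOdd _ _ hl]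
    · rw [add_tsub_cancel_right]
      rcases lt_or_ge ℓ 0 with h | h
      · rw [below_odd_neg h]
        rcases m with _ | m
        · rw [above_even (Or.inr rfl)]
          exact belowEven_zero _ _ _ _
        · rw [mul_add, mul_one, above_even_succ h, Nat.cast_succ, belowEven_eq_aboveOdd _ _ hl]
      · rw [below_odd h, above_even (Or.inl h), belowOdd_eq_aboveEven _ _ hl]
  match_up r a b n hl h0 := by
    rcases Nat.even_or_odd' r with ⟨m, rfl | rfl⟩
    · rcases m with _ | m
      · have h1 := above_even (ℓ := ℓ) (m := 0) (Or.inr rfl)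
        have h2 := below_even (ℓ := ℓ) (m := 0) (Or.inr rfl)
        rw [mul_zero] at h1 h2
        rw [mul_zero, zero_tsub, h2, h1]
        simp only [Nat.cast_zero, belowEven_zero]
      · rw [show 2 * (m + 1) - 1 = 2 * m + 1 by omega]
        rcases lt_or_ge ℓ 0 with h | h
        · rw [mul_add, mul_one, above_even_succ h, below_odd_neg h,
            aboveOdd_sub (by omega) hl (by omega) (by omega)]
        · rw [above_even (Or.inl h), below_odd h, Nat.cast_succ,
            aboveEven_sub (by omega) hl (by omega) (by omega)]
    · rw [add_tsub_cancel_right]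
      rcases lt_or_ge 0 ℓ with h | h
      · rw [above_odd_pos h]
        rcases m with _ | m
        · rw [below_even (Or.inr rfl)]
          simp only [Nat.cast_zero, belowEven_zero]
        · rw [mul_add, mul_one, below_even_succ h, Nat.cast_succ,
            aboveEven_sub (by omega) hl (by omega) (by omega)]
      · rw [above_odd h, below_even (Or.inl h),
          aboveOdd_sub (by omega) hl (by omega) (by omega)]

end LatticePath

/-! ### Reading off the cases, in particular end points on the line. -/

namespace LatticePath

theorem eq_tSum {p : (RatFunc ℚ)[X]} {c : ℕ → RatFunc ℚ} (h : ∀ n, p.coeff n = c n) :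
    p = tSum c := by
  obtain rfl : p.coeff = c := funext h
  rw [tSum, finsum_eq_sum_of_support_subset (s := p.support)]
  · conv_lhs => rw [p.as_sum_support_C_mul_X_pow]
    exact Finset.sum_congr rfl fun n _ => mul_comm _ _
  · intro n hn
    by_contra h0
    rw [Finset.mem_coe, notMem_support_iff] at h0
    simp [h0] at hn

variable {ℓ : ℤ} {a b : ℕ}

theorem coeff_G_above (hl : ℓ < (a : ℤ) - b) (r n : ℕ) :
    (G a b r ℓ).coeff n = above ℓ r a b n := (isClosedForm ℓ).coeff_G_above hl r n

theorem coeff_G_below (hl : ℓ > (a : ℤ) - b) (r n : ℕ) :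
    (G a b r ℓ).coeff n = below ℓ r a b n := (isClosedForm ℓ).coeff_G_below hl r n

theorem coeff_G_on (hl : ℓ = (a : ℤ) - b) (r n : ℕ) :
    (G a b r ℓ).coeff n = below ℓ r a b n - below ℓ r a (b - 1) n + above ℓ r a (b - 1) n :=
  (isClosedForm ℓ).coeff_G_on hl r n

/-- If `A` does not change from `r - 1` to `r`, `match_down` cancels the two terms at `b - 1` in
`coeff_G_on`. -/
theorem coeff_G_on_of_below_eq_above (hl : ℓ = (a : ℤ) - b) {r : ℕ}
    (h : above ℓ (r - 1) = above ℓ r) (n : ℕ) : (G a b r ℓ).coeff n = below ℓ r a b n := by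
  rw [coeff_G_on hl, (isClosedForm ℓ).match_down r a (b - 1) n (by omega), h, sub_add_cancel]

/-- If `B` does not change from `r - 1` to `r`, `match_up` turns the `B` difference in `coeff_G_on`
into an `A` difference, which telescopes. -/
theorem coeff_G_on_of_below_sub_one (hl : ℓ = (a : ℤ) - b) (h0 : ℓ ≠ 0) {r : ℕ}
    (h : below ℓ (r - 1) = below ℓ r) (n : ℕ) : (G a b r ℓ).coeff n = above ℓ r a b n := by
  have := (isClosedForm ℓ).match_up r a b n hl.symm (by omega)
  rw [coeff_G_on hl, ← h, ← this, sub_add_cancel]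

/-- For `ℓ = 0` neither shortcut applies, so all three terms of `coeff_G_on` remain. After
multiplication by `1 - q^a` they share the factor `[a, n+m] [a, n-m]`, and `q^(a-n-m) (1 - q^(n-m))
+ (1 - q^(a-n-m)) = 1 - q^(a-2m)`. -/
theorem coeff_G_diagonal_even (ha : 0 < a) (m n : ℕ) :
    (G a a (2 * m) 0).coeff n = q ^ ((n : ℤ) ^ 2 + (m : ℤ) * (m + 1)) *
      ((1 - q ^ ((a : ℤ) - 2 * m)) / (1 - q ^ a)) *
      (qbin a ((n : ℤ) + m) * qbin a ((n : ℤ) - m)) := by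
  rw [coeff_G_on (by simp), above_even (by omega), below_even (by omega), ← zpow_natCast q a]
  have ha' : (0 : ℤ) < a := by omega
  have h0 := one_sub_q_zpow_ne_zero ha'
  have e0 := qbin_sub_qbin_sub_one ha'.ne' ((n : ℤ) - m)
  have e1 := qbin_sub_one_mul ha' ((n : ℤ) + m)
  have e2 := qbin_sub_one_sub_one_mul ha' ((n : ℤ) - m)
  have z1 : q ^ ((n : ℤ) ^ 2 + (m : ℤ) * (m - 1)) * q ^ ((a : ℤ) - (n - m)) =
      q ^ ((n : ℤ) ^ 2 + (m : ℤ) * (m + 1)) * q ^ ((a : ℤ) - (n + m)) := by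
    simp only [← zpow_add₀ q_ne_zero]
    congr 1
    ring
  have z2 : q ^ ((a : ℤ) - 2 * m) = q ^ ((a : ℤ) - (n + m)) * q ^ ((n : ℤ) - m) := by
    rw [← zpow_add₀ q_ne_zero]
    congr 1
    ring
  rw [belowEven, qterm_eq (e := (n : ℤ) ^ 2 + m * (m - 1)) (by ring) rfl rfl,
    belowEven, qterm_eq (e := (n : ℤ) ^ 2 + m * (m - 1)) (by ring) rfl rfl, aboveEven,
    qterm_eq (e := (n : ℤ) ^ 2 + m * (m + 1)) (k := n - m) (j := n + m) (by ring) (by ring)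
    (by ring), z2]
  rw [mul_div_assoc', div_mul_eq_mul_div, eq_div_iff h0]
  linear_combination (q ^ ((n : ℤ) ^ 2 + (m : ℤ) * (m - 1)) * qbin a (n + m) * (1 - q ^ (a : ℤ))) * e0
    + (q ^ ((n : ℤ) ^ 2 + (m : ℤ) * (m - 1)) * qbin a (n + m) * q ^ ((a : ℤ) - (n - m))) * e2
    + (q ^ ((n : ℤ) ^ 2 + (m : ℤ) * (m + 1)) * qbin a (n - m)) * e1
    + (qbin a (n + m) * qbin a (n - m) * (1 - q ^ ((n : ℤ) - m))) * z1

/-- The same computation with common factor `[a, n+m+1] [a, n-m-1]` and `q^(a+1-n+m) (1 - q^(n+m+1))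
+ (1 - q^(a+1-n+m)) = 1 - q^(a+2m+2)`. -/
theorem coeff_G_diagonal_odd (ha : 0 < a) (m n : ℕ) :
    (G a a (2 * m + 1) 0).coeff n = q ^ ((n : ℤ) ^ 2 + (m : ℤ) * (m + 1)) *
      ((1 - q ^ ((a : ℤ) + 2 * (m + 1))) / (1 - q ^ a)) *
      (qbin a ((n : ℤ) + m + 1) * qbin a ((n : ℤ) - m - 1)) := by
  rw [coeff_G_on (by simp), above_odd le_rfl, below_odd le_rfl, ← zpow_natCast q a]
  have ha' : (0 : ℤ) < a := by omega
  have h0 := one_sub_q_zpow_ne_zero ha'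
  have e0 := qbin_sub_qbin_sub_one (show (a : ℤ) + 1 ≠ 0 by omega) ((n : ℤ) - m)
  rw [add_sub_cancel_right] at e0
  have e1 := qbin_sub_one_sub_one_mul ha' ((n : ℤ) + m + 1)
  rw [add_sub_cancel_right] at e1
  have e2 := qbin_sub_one_mul ha' ((n : ℤ) - m - 1)
  have z2 : q ^ ((a : ℤ) + 2 * (m + 1)) = q ^ ((a : ℤ) + 1 - (n - m)) * q ^ ((n : ℤ) + m + 1) := by
    rw [← zpow_add₀ q_ne_zero]
    congr 1
    ring
  rw [show (a : ℤ) - (n - m - 1) = a + 1 - (n - m) by ring] at e2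
  rw [belowOdd, qterm_eq (e := (n : ℤ) ^ 2 + m * (m + 1)) (by ring) rfl rfl,
    belowOdd, qterm_eq (e := (n : ℤ) ^ 2 + m * (m + 1)) (by ring) rfl rfl, aboveOdd,
    qterm_eq (e := (n : ℤ) ^ 2 + m * (m + 1)) (k := n - m - 1) (j := n + m + 1) (by ring) (by ring)
    (by ring), z2]
  rw [mul_div_assoc', div_mul_eq_mul_div, eq_div_iff h0]
  simp only [sub_zero, add_zero, sub_add_cancel]
  linear_combination (q ^ ((n : ℤ) ^ 2 + (m : ℤ) * (m + 1))) *
    ((qbin (a - 1) (n + m) * (1 - q ^ (a : ℤ))) * e0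
    + (q ^ ((a : ℤ) + 1 - (n - m)) * qbin a (n - m - 1)) * e1 + qbin a (n + m + 1) * e2)

theorem G_zero_zero (r : ℕ) : G 0 0 r 0 = if r = 0 then 1 else 0 := by
  simp [G_eq_add, emptySum, lastStepSum_up_zero, lastStepSum_down_zero]

end LatticePath

theorem theorem2p1 (a b m : ℕ) (ℓ : ℤ) :
    (0 < ℓ ∧ ℓ < (a : ℤ) - b →
      G a b (2 * m + 1) ℓ = G a b (2 * m) ℓ ∧
      G a b (2 * m) ℓ = tSum (fun n : ℕ => q ^ ((n : ℤ) ^ 2 + (m : ℤ) * (m + ℓ + 1)) *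
        (qbin a ((n : ℤ) - m) * qbin b ((n : ℤ) + m)))) ∧
    (0 > ℓ ∧ ℓ > (a : ℤ) - b →
      G a b (2 * m + 1) ℓ = G a b (2 * m) ℓ ∧
      G a b (2 * m) ℓ = tSum (fun n : ℕ => q ^ ((n : ℤ) ^ 2 + (m : ℤ) * (m - ℓ - 1)) *
        (qbin a ((n : ℤ) + m) * qbin b ((n : ℤ) - m)))) ∧
    (0 > ℓ ∧ ℓ < (a : ℤ) - b →
      G a b (2 * m + 2) ℓ = G a b (2 * m + 1) ℓ ∧
      G a b (2 * m + 1) ℓ = tSum (fun n : ℕ => q ^ ((n : ℤ) ^ 2 + ((m : ℤ) + 1) * (m - ℓ)) *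
        (qbin ((a : ℤ) - ℓ - 1) ((n : ℤ) - m - 1) * qbin ((b : ℤ) + ℓ + 1) ((n : ℤ) + m + 1)))) ∧
    (0 < ℓ ∧ ℓ > (a : ℤ) - b →
      G a b (2 * m + 2) ℓ = G a b (2 * m + 1) ℓ ∧
      G a b (2 * m + 1) ℓ = tSum (fun n : ℕ => q ^ ((n : ℤ) ^ 2 + (m : ℤ) * (m + ℓ + 1)) *
        (qbin ((a : ℤ) - ℓ - 1) ((n : ℤ) + m) * qbin ((b : ℤ) + ℓ + 1) ((n : ℤ) - m)))) ∧
    (0 = ℓ ∧ ℓ < (a : ℤ) - b →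
      G a b (2 * m) ℓ = tSum (fun n : ℕ => q ^ ((n : ℤ) ^ 2 + (m : ℤ) * (m + 1)) *
        (qbin a ((n : ℤ) - m) * qbin b ((n : ℤ) + m))) ∧
      G a b (2 * m + 1) ℓ = tSum (fun n : ℕ => q ^ ((n : ℤ) ^ 2 + (m : ℤ) * (m + 1)) *
        (qbin ((a : ℤ) - 1) ((n : ℤ) - m - 1) * qbin ((b : ℤ) + 1) ((n : ℤ) + m + 1)))) ∧
    (0 = ℓ ∧ ℓ > (a : ℤ) - b →
      G a b (2 * m) ℓ = tSum (fun n : ℕ => q ^ ((n : ℤ) ^ 2 + (m : ℤ) * (m - 1)) *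
        (qbin a ((n : ℤ) + m) * qbin b ((n : ℤ) - m))) ∧
      G a b (2 * m + 1) ℓ = tSum (fun n : ℕ => q ^ ((n : ℤ) ^ 2 + (m : ℤ) * (m + 1)) *
        (qbin ((a : ℤ) - 1) ((n : ℤ) + m) * qbin ((b : ℤ) + 1) ((n : ℤ) - m)))) ∧
    (0 < ℓ ∧ ℓ = (a : ℤ) - b →
      G a b (2 * m) ℓ = tSum (fun n : ℕ => q ^ ((n : ℤ) ^ 2 + (m : ℤ) * (m + ℓ + 1)) *
        (qbin a ((n : ℤ) - m) * qbin b ((n : ℤ) + m))) ∧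
      G a b (2 * m + 1) ℓ = tSum (fun n : ℕ => q ^ ((n : ℤ) ^ 2 + (m : ℤ) * (m + ℓ + 1)) *
        (qbin ((a : ℤ) + 1) ((n : ℤ) - m) * qbin ((b : ℤ) - 1) ((n : ℤ) + m)))) ∧
    (0 > ℓ ∧ ℓ = (a : ℤ) - b →
      G a b (2 * m) ℓ = tSum (fun n : ℕ => q ^ ((n : ℤ) ^ 2 + (m : ℤ) * (m - ℓ - 1)) *
        (qbin a ((n : ℤ) + m) * qbin b ((n : ℤ) - m))) ∧
      G a b (2 * m + 1) ℓ = tSum (fun n : ℕ => q ^ ((n : ℤ) ^ 2 + ((m : ℤ) + 1) * (m - ℓ)) *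
        (qbin ((a : ℤ) + 1) ((n : ℤ) + m + 1) * qbin ((b : ℤ) - 1) ((n : ℤ) - m - 1)))) ∧
    (0 = ℓ ∧ ℓ = (a : ℤ) - b ∧ 0 < a →
      G a b (2 * m) ℓ = tSum (fun n : ℕ => q ^ ((n : ℤ) ^ 2 + (m : ℤ) * (m + 1)) *
        ((1 - q ^ ((a : ℤ) - 2 * m)) / (1 - q ^ a)) *
        (qbin a ((n : ℤ) + m) * qbin a ((n : ℤ) - m))) ∧
      G a b (2 * m + 1) ℓ = tSum (fun n : ℕ => q ^ ((n : ℤ) ^ 2 + (m : ℤ) * (m + 1)) *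
        ((1 - q ^ ((a : ℤ) + 2 * (m + 1))) / (1 - q ^ a)) *
        (qbin a ((n : ℤ) + m + 1) * qbin a ((n : ℤ) - m - 1)))) ∧
    (0 = ℓ ∧ ℓ = (a : ℤ) - b ∧ a = 0 →
      G a b (2 * m) ℓ = (if m = 0 then 1 else 0) ∧
      G a b (2 * m + 1) ℓ = 0) := by
  refine ⟨fun ⟨h, hl⟩ => ?_, fun ⟨h, hl⟩ => ?_, fun ⟨h, hl⟩ => ?_, fun ⟨h, hl⟩ => ?_,
    fun ⟨h, hl⟩ => ?_, fun ⟨h, hl⟩ => ?_, fun ⟨h, hl⟩ => ?_, fun ⟨h, hl⟩ => ?_,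
    fun ⟨h, hl, ha⟩ => ?_, fun ⟨h, hl, ha⟩ => ?_⟩
  · refine ⟨Polynomial.ext fun n => ?_, eq_tSum fun n => ?_⟩
    · rw [coeff_G_above hl, coeff_G_above hl, above_odd_pos h, above_even (Or.inl h.le)]
    · rw [coeff_G_above hl, above_even (Or.inl h.le)]
      exact qterm_eq (by ring) (by ring) (by ring)
  · refine ⟨Polynomial.ext fun n => ?_, eq_tSum fun n => ?_⟩
    · rw [coeff_G_below hl, coeff_G_below hl, below_odd_neg h, below_even (Or.inl h.le)]
    · rw [coeff_G_below hl, below_even (Or.inl h.le)]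
      exact qterm_eq (by ring) (by ring) (by ring)
  · refine ⟨Polynomial.ext fun n => ?_, eq_tSum fun n => ?_⟩
    · rw [coeff_G_above hl, coeff_G_above hl, above_odd h.le, above_even_succ h]
    · rw [coeff_G_above hl, above_odd h.le]
      exact qterm_eq (by ring) (by ring) (by ring)
  · refine ⟨Polynomial.ext fun n => ?_, eq_tSum fun n => ?_⟩
    · rw [coeff_G_below hl, coeff_G_below hl, below_odd h.le, below_even_succ h]
    · rw [coeff_G_below hl, below_odd h.le]
      exact qterm_eq (by ring) (by ring) (by ring)
  · subst h
    refine ⟨eq_tSum fun n => ?_, eq_tSum fun n => ?_⟩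
    · rw [coeff_G_above hl, above_even (Or.inl le_rfl)]
      exact qterm_eq (by ring) (by ring) (by ring)
    · rw [coeff_G_above hl, above_odd le_rfl, aboveOdd, sub_zero, add_zero]
      exact qterm_eq (by ring) (by ring) (by ring)
  · subst h
    refine ⟨eq_tSum fun n => ?_, eq_tSum fun n => ?_⟩
    · rw [coeff_G_below hl, below_even (Or.inl le_rfl)]
      exact qterm_eq (by ring) (by ring) (by ring)
    · rw [coeff_G_below hl, below_odd le_rfl, belowOdd, sub_zero, add_zero]
      exact qterm_eq (by ring) (by ring) (by ring)
  · refine ⟨eq_tSum fun n => ?_, eq_tSum fun n => ?_⟩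
    · rw [coeff_G_on_of_below_sub_one hl h.ne', above_even (Or.inl h.le)]
      · exact qterm_eq (by ring) (by ring) (by ring)
      · rcases m with _ | m
        -- For `m = 0` both indices are `0`, by truncated subtraction.
        · rfl
        · rw [show 2 * (m + 1) - 1 = 2 * m + 1 by omega, below_odd h.le, mul_add, mul_one,
            below_even_succ h]
    -- With `ℓ = a - b` the shifted arguments are `b - 1` and `a + 1`, so the two factors have to
    -- trade places.
    · rw [coeff_G_on_of_below_eq_above hl, below_odd h.le, belowOdd, qterm_swap,
        show (a : ℤ) - ℓ - 1 = b - 1 by omega, show (b : ℤ) + ℓ + 1 = a + 1 by omega]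
      · exact qterm_eq (by ring) (by ring) (by ring)
      · rw [add_tsub_cancel_right, above_even (Or.inl h.le), above_odd_pos h]
  · refine ⟨eq_tSum fun n => ?_, eq_tSum fun n => ?_⟩
    · rw [coeff_G_on_of_below_eq_above hl, below_even (Or.inl h.le)]
      · exact qterm_eq (by ring) (by ring) (by ring)
      · rcases m with _ | m
        · rfl
        · rw [show 2 * (m + 1) - 1 = 2 * m + 1 by omega, above_odd h.le, mul_add, mul_one,
            above_even_succ h]
    · rw [coeff_G_on_of_below_sub_one hl h.ne, above_odd h.le, aboveOdd, qterm_swap,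
        show (a : ℤ) - ℓ - 1 = b - 1 by omega, show (b : ℤ) + ℓ + 1 = a + 1 by omega]
      · exact qterm_eq (by ring) (by ring) (by ring)
      · rw [add_tsub_cancel_right, below_even (Or.inl h.le), below_odd_neg h]
  · obtain rfl : a = b := by omega
    subst h
    exact ⟨eq_tSum fun n => coeff_G_diagonal_even ha m n,
      eq_tSum fun n => coeff_G_diagonal_odd ha m n⟩
  · obtain rfl : b = 0 := by omega
    subst h ha
    exact ⟨by simp [G_zero_zero], by simp [G_zero_zero]⟩
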